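/- **Setting.** For a directed graph (an irreflexive, asymmetric relation $E$) write $x\perp y$ if neither $E(x,y)$ nor $E(y,x)$. Let $\mathcal S$ (the semigeneric class) be the class of finite directed graphs such that $\perp$ is an equivalence relation, whose classes are called parts, and such that for any two distinct parts $P,P'$, distinct $u,v\in P$ and distinct $x,y\in P'$, the number of edges directed from $\{u,v\}$ to $\{x,y\}$ is even. Let $\mathcal S^*$ be the class of structures $\mathbf A^*=(A,E,R,<)$ obtained as follows from some $\mathbf A=(A,E)\in\mathcal S$ with exactly $k$ parts. Take a $k$-partite $\bar{\mathbf A}\in\mathcal S$ on the disjoint union of $A$ and $T=\{t_i:i<k\}$ which induces $E$ on $A$, induces the edges $t_i\to t_j$ ($i<j$) on $T$, and in which $T$ is a transversal, i.e. meets each part in exactly one point. Put $R(x,u)$ iff $x,u\in A$ lie in different parts and there is an edge $t_i\to u$ in $\bar{\mathbf A}$, where $t_i$ is the point of $T$ in the part of $x$. Let $<$ be the restriction to $A$ of a linear order on $\bar{\mathbf A}$ that extends $t_0<\dots<t_{k-1}$ and in which every part is convex. Let $\mathcal{AS}$ be the class of the reducts $(A,E,R)$ of members of $\mathcal S^*$.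 For $n,k\in\mathbb N$ let $\mathbf S[n,k]$ be the directed graph on the triples $(i,f,j)$ with $i<k$, $f:\{0,\dots,k-1\}\setminus\{i\}\to\{0,1\}$, $j<n$, defined as follows. There is no edge between triples with the same $i$. Use imaginary points $t_0,\dots,t_{k-1}$ with edges $t_{i'}\to t_i$ for $i'<i$, and, for $i\ne i'$, $t_{i'}\to(i,f,j)$ if $f(i')=0$ and $(i,f,j)\to t_{i'}$ otherwise. For $i\neq i'$ the edge between $p=(i,f,j)$ and $q=(i',f',j')$ is given the unique direction for which the number of edges from $\{p,t_i\}$ to $\{q,t_{i'}\}$ is even. An expansion of a structure is a structure on the same universe with additional relations of which it is the reduct; a structure contains another if the latter embeds in it as an induced substructure. **Theorem.** 1. Every $\mathbf A\in\mathcal S$ has an expansion in $\mathcal S^*$. 2. For every $\mathbf A^*\in\mathcal S^*$ there exists $\bar{\mathbf B}\in\mathcal{AS}$ such that every expansion of $\bar{\mathbf B}$ in $\mathcal S^*$ contains $\mathbf A^*$. 3. For all $n,k\in\mathbb N$, $\mathbf S[n,k]\in\mathcal S$, and any two expansions of $\mathbf S[n,k]$ in $\mathcal{AS}$ are isomorphic.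 4. For every $\bar{\mathbf B}\in\mathcal{AS}$ there exists $\mathbf B\in\mathcal S$, which can be taken of the form $\mathbf B=\mathbf S[n,k]$, such that every expansion of $\mathbf B$ in $\mathcal{AS}$ contains $\bar{\mathbf B}$. 5. $\mathcal S^*$ has the expansion property relative to $\mathcal S$: for every $\mathbf A\in\mathcal S$ there exists $\mathbf B\in\mathcal S$ such that every expansion of $\mathbf A$ in $\mathcal S^*$ embeds in every expansion of $\mathbf B$ in $\mathcal S^*$. -/

import Mathlib

universe u v

namespace Semigeneric

/-- The indicator of a proposition, as a natural number. -/
noncomputable def ind (p : Prop) : ℕ := by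
  classical exact if p then 1 else 0

/-- The non-edge relation `⊥` of a directed graph. -/
def NonEdge {V : Type u} (E : V → V → Prop) (x y : V) : Prop := ¬ E x y ∧ ¬ E y x

/-- The number of edges directed from `{u, v}` to `{x, y}`, for `u ≠ v` and `x ≠ y`. -/
noncomputable def edgeCount {V : Type u} (E : V → V → Prop) (u v x y : V) : ℕ :=
  ind (E u x) + ind (E u y) + ind (E v x) + ind (E v y)

/-- The class `𝒮`: finite directed graphs whose non-edge relation is an equivalence relation
(the age of `ω * I_ω`; the classes of `⊥` are the parts), and in which the number of edges from a
pair of distinct points of a part to a pair of distinct points of another part is even. -/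
structure IsS {V : Type u} (E : V → V → Prop) : Prop where
  finite : Finite V
  asymm : ∀ x y, E x y → ¬ E y x
  nonEdge_equiv : Equivalence (NonEdge E)
  parity : ∀ u v x y, NonEdge E u v → NonEdge E x y → ¬ NonEdge E u x → u ≠ v → x ≠ y →
    Even (edgeCount E u v x y)

/-- `lt` is a strict linear order. -/
structure IsLinearOrd {V : Type u} (lt : V → V → Prop) : Prop where
  irrefl : ∀ x, ¬ lt x x
  trans : ∀ x y z, lt x y → lt y z → lt x z
  total : ∀ x y, x ≠ y → lt x y ∨ lt y x

/-- Every part of the directed graph `E` is an interval of `lt`. -/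
def IsConvexOrd {V : Type u} (E lt : V → V → Prop) : Prop :=
  ∀ x y z, lt x y → lt y z → NonEdge E x z → NonEdge E x y

/-- The class `𝒮*`: `(V, E, R, lt)` arises from the `k`-partite `(V, E)` in `𝒮` by choosing
a `k`-partite `Ebar` in `𝒮` on the disjoint union of `V` and a transitive tournament
`T = {t_0, …, t_{k-1}}` (the summand `Fin k`), in which `V` and `T` keep their edges and `T` is
a transversal, and a convex linear order `ltbar` extending that of `T`.  Then `R x u` says that `x`
and `u` lie in different parts and `t_i → u` for the point `t_i` in the part of `x`, and `lt` is
the restriction of `ltbar` to `V`. -/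
def IsSStar {V : Type u} (E R lt : V → V → Prop) : Prop :=
  IsS E ∧
  ∃ (k : ℕ) (Ebar ltbar : V ⊕ Fin k → V ⊕ Fin k → Prop),
    IsS Ebar ∧
    (∀ x y : V, Ebar (.inl x) (.inl y) ↔ E x y) ∧
    (∀ i j : Fin k, Ebar (.inr i) (.inr j) ↔ i < j) ∧
    (∀ x : V, ∃ i : Fin k, NonEdge Ebar (.inl x) (.inr i)) ∧
    (∀ i : Fin k, ∃ x : V, NonEdge Ebar (.inl x) (.inr i)) ∧
    (∀ x u : V, R x u ↔
      ¬ NonEdge E x u ∧ ∃ i : Fin k, NonEdge Ebar (.inl x) (.inr i) ∧ Ebar (.inr i) (.inl u)) ∧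
    IsLinearOrd ltbar ∧
    IsConvexOrd Ebar ltbar ∧
    (∀ i j : Fin k, i < j → ltbar (.inr i) (.inr j)) ∧
    (∀ x y : V, lt x y ↔ ltbar (.inl x) (.inl y))

/-- The class `𝒜𝒮`: elements of `𝒮*` with the ordering removed. -/
def IsAS {V : Type u} (E R : V → V → Prop) : Prop := ∃ lt : V → V → Prop, IsSStar E R lt

/-- `(V, E, R)` embeds in `(W, E', R')`. -/
def EmbedsAS {V : Type u} {W : Type v} (E R : V → V → Prop) (E' R' : W → W → Prop) : Prop :=
  ∃ φ : V ↪ W, ∀ x y, (E' (φ x) (φ y) ↔ E x y) ∧ (R' (φ x) (φ y) ↔ R x y)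

/-- `(V, E, R)` and `(W, E', R')` are isomorphic. -/
def IsoAS {V : Type u} {W : Type v} (E R : V → V → Prop) (E' R' : W → W → Prop) : Prop :=
  ∃ φ : V ≃ W, ∀ x y, (E' (φ x) (φ y) ↔ E x y) ∧ (R' (φ x) (φ y) ↔ R x y)

/-- `(V, E, R, lt)` embeds in `(W, E', R', lt')`. -/
def EmbedsSStar {V : Type u} {W : Type v} (E R lt : V → V → Prop) (E' R' lt' : W → W → Prop) :
    Prop :=
  ∃ φ : V ↪ W, ∀ x y,
    (E' (φ x) (φ y) ↔ E x y) ∧ (R' (φ x) (φ y) ↔ R x y) ∧ (lt' (φ x) (φ y) ↔ lt x y)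

/-- The expansion property of a class `Kstar` of structures in the language `{E, R, <}` relative
to a class `K` of structures in the language `{E}`. -/
def HasExpansionProperty
    (Kstar : ∀ {V : Type u}, (V → V → Prop) → (V → V → Prop) → (V → V → Prop) → Prop)
    (K : ∀ {V : Type u}, (V → V → Prop) → Prop) : Prop :=
  ∀ (A : Type u) (E : A → A → Prop), K E →
    ∃ (B : Type u) (EB : B → B → Prop), K EB ∧
      ∀ (R lt : A → A → Prop) (RB ltB : B → B → Prop),
        Kstar E R lt → Kstar EB RB ltB → EmbedsSStar E R lt EB RB ltB

/-- The universe of `S[n,k]`: triples `(i, f, j)` with `i < k`, `f` a function from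
`[k] ∖ {i}` to `[2]`, and `j < n`. -/
abbrev SnkV (n k : ℕ) : Type := (i : Fin k) × (({j : Fin k // j ≠ i} → Fin 2) × Fin n)

/-- The edge relation of `S[n,k]`.  Imaginary points `t_i` satisfy `t_i → t_{i'}` iff `i < i'`, and
`t_{i'} → (i, f, j)` iff `f i' = 0`, the reverse edge being present otherwise.  For `p = (i, f, j)`
and `q = (i', f', j')` with `i ≠ i'`, there is an edge `p → q` iff its presence makes the number
of edges from `{p, t_i}` to `{q, t_{i'}}` even; the summands below are the contributions of
`p → q`, `p → t_{i'}`, `t_i → q`, `t_i → t_{i'}`. -/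
def SnkE (n k : ℕ) (p q : SnkV n k) : Prop :=
  ∃ h : p.1 ≠ q.1,
    Even (1 + ind (p.2.1 ⟨q.1, h.symm⟩ ≠ 0) + ind (q.2.1 ⟨p.1, h⟩ = 0) + ind (p.1 < q.1))

end Semigeneric

/-!
The members of `𝒮*` are described by coordinates (`Coord`, `IsSStar.exists_coord`): a numbering
`π : V → Fin k` of the parts and, for each vertex `u` and each part `i` not containing `u`, a truth
value `ρ i u` saying `t_i → u`.  Parity determines the edges from `π` and `ρ`, the relation `R` is
`ρ` itself, and the order is any linear order refining `π`.  Conversely all coordinates arise, and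
every member of `𝒮` has some (`IsS.exists_eq_coordE`), which gives expansions.

Given coordinates of `S[n,k]`, sending a point to the standard point with the same coordinates and
the same index `j < n` permutes `S[n,k]`, as it is injective (`Coord.snkMap_bijective`).  Hence every
unordered expansion is isomorphic to the standard one (`isoAS_snkR`), and in every expansion all
types occur `n` times in each part (`Coord.exists_point`).

The remaining claims follow from one fact: every expansion of a large `S[n,K]` contains a given
member `V` of `𝒮*` (`Coord.exists_bound`).  Only the order inside the parts is not under control.
Let `V` have `k` parts and split the parts of `S[n,K]` into `k` intervals of length `L`; a choice of
one part from each interval is a candidate for the parts of a copy of `V`.  It works if for each `i`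
the `i`-th chosen part contains points realising, in the correct order, the types of the points of
the `i`-th part of `V` over the other chosen parts.  With the `i`-th chosen part fixed, at most
`|V|!` pairwise disjoint choices of the others can fail (`Coord.card_bad_le`): otherwise points can be
chosen whose types list the points of `V` in a different arrangement over each such choice, one for
each permutation, and whatever the order of the chosen points, one arrangement is sorted.  Averaging
over shifts, a choice fails at `i` with frequency at most `|V|! / L`, so some choice fails nowhere
once `L > k |V|!` (`exists_forall_not_of_card_le`).
-/

namespace Semigeneric

open Function

/-! ### Linear orders on finite types -/

lemma IsLinearOrd.comap {V : Type u} {W : Type v} {lt : W → W → Prop} (h : IsLinearOrd lt)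
    {f : V → W} (hf : Injective f) : IsLinearOrd fun x y => lt (f x) (f y) :=
  ⟨fun _ => h.irrefl _, fun _ _ _ => h.trans _ _ _, fun _ _ hxy => h.total _ _ (hf.ne hxy)⟩

lemma IsLinearOrd.asymm {V : Type u} {lt : V → V → Prop} (h : IsLinearOrd lt) {x y : V}
    (hxy : lt x y) : ¬ lt y x := fun hyx => h.irrefl _ (h.trans _ _ _ hxy hyx)

lemma IsLinearOrd.exists_equiv_fin {V : Type u} [Finite V] {lt : V → V → Prop}
    (h : IsLinearOrd lt) : ∃ e : V ≃ Fin (Nat.card V), ∀ x y, lt x y ↔ e x < e y := by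
  classical
  have : Fintype V := Fintype.ofFinite V
  have : IsStrictTotalOrder V lt :=
    { irrefl := h.irrefl
      trans := h.trans
      trichotomous := fun a b hab hba => by
        by_contra hne
        exact (h.total a b hne).elim hab hba }
  let _ : LinearOrder V := linearOrderOfSTO lt
  let e := Fintype.orderIsoFinOfCardEq V (Nat.card_eq_fintype_card (α := V)).symm
  exact ⟨e.symm.toEquiv, fun x y => (e.symm.lt_iff_lt (x := x) (y := y)).symm⟩

/-- Any two linear orders on a finite set are isomorphic. -/
lemma IsLinearOrd.exists_perm {V : Type u} [Finite V] {lt lt' : V → V → Prop}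
    (h : IsLinearOrd lt) (h' : IsLinearOrd lt') :
    ∃ τ : Equiv.Perm V, ∀ x y, lt x y ↔ lt' (τ x) (τ y) := by
  obtain ⟨e, he⟩ := h.exists_equiv_fin
  obtain ⟨e', he'⟩ := h'.exists_equiv_fin
  exact ⟨e.trans e'.symm, fun x y => by simp [he, he']⟩

/-- The lexicographic order of a map to `Fin k` and an injection into `Fin m`. -/
lemma isLinearOrd_lex {V : Type u} {k m : ℕ} (π : V → Fin k) (e : V ≃ Fin m) :
    IsLinearOrd fun x y => π x < π y ∨ π x = π y ∧ e x < e y where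
  irrefl x := by simp
  trans x y z := by
    rintro (h | ⟨h, h'⟩) (g | ⟨g, g'⟩)
    · exact .inl (h.trans g)
    · exact .inl (g ▸ h)
    · exact .inl (h ▸ g)
    · exact .inr ⟨h.trans g, h'.trans g'⟩
  total x y hxy := by
    have := e.injective.ne hxy
    grind

/-! ### Coordinates -/

/-- The directed graph with parts the fibres of `π`, in which `ρ i u` says that the imaginary point
`t_i` of the part `i` has an edge to `u`: the direction of an edge between `x` and `y` is the one
imposed by parity on `{x, t_{π x}}` and `{y, t_{π y}}` when `t_i → t_j` for `i < j`.  The value of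
`ρ (π u) u` is irrelevant. -/
def coordE {V : Type u} {k : ℕ} (π : V → Fin k) (ρ : Fin k → V → Prop) (x y : V) : Prop :=
  π x ≠ π y ∧ ¬ (π x < π y ↔ (ρ (π x) y ↔ ρ (π y) x))

/-- `π` and `ρ` are coordinates of `(V, E, R, lt)`: `E` and `R` are read off from them and `lt`
refines the numbering `π` of the parts. -/
structure Coord {V : Type u} (E R lt : V → V → Prop) {k : ℕ} (π : V → Fin k)
    (ρ : Fin k → V → Prop) : Prop where
  surj : Surjective π
  edge : ∀ x y, E x y ↔ coordE π ρ x y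
  rel : ∀ x y, R x y ↔ π x ≠ π y ∧ ρ (π x) y
  lin : IsLinearOrd lt
  mono : ∀ x y, π x < π y → lt x y

lemma ind_true {p : Prop} (h : p) : ind p = 1 := by simp [ind, h]

/-- The parity of a sum of four indicators, as an equivalence of propositions. -/
lemma even_ind_iff (a b c d : Prop) :
    Even (ind a + ind b + ind c + ind d) ↔ ((a ↔ b) ↔ (c ↔ d)) := by
  by_cases ha : a <;> by_cases hb : b <;> by_cases hc : c <;> by_cases hd : d <;>
    simp [ind, ha, hb, hc, hd] <;> decide

section coordE

variable {V : Type u} {k : ℕ} {π : V → Fin k} {ρ : Fin k → V → Prop}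

lemma coordE_swap {x y : V} (h : π x ≠ π y) : coordE π ρ x y ↔ ¬ coordE π ρ y x := by
  unfold coordE
  rcases lt_or_gt_of_ne h with h' | h' <;> simp [h, h.symm, h', h'.not_gt] <;> tauto

lemma nonEdge_coordE {x y : V} : NonEdge (coordE π ρ) x y ↔ π x = π y := by
  by_cases h : π x = π y
  · simp [NonEdge, coordE, h]
  · have := coordE_swap (ρ := ρ) h
    unfold NonEdge
    tauto

lemma isS_coordE [Finite V] (π : V → Fin k) (ρ : Fin k → V → Prop) : IsS (coordE π ρ) where
  finite := inferInstance
  asymm x y h := (coordE_swap h.1).1 h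
  nonEdge_equiv := by
    exact ⟨fun _ => nonEdge_coordE.2 rfl,
      fun h => nonEdge_coordE.2 (nonEdge_coordE.1 h).symm,
      fun h g => nonEdge_coordE.2 ((nonEdge_coordE.1 h).trans (nonEdge_coordE.1 g))⟩
  parity u v x y huv hxy hux _ _ := by
    rw [nonEdge_coordE] at huv hxy hux
    rw [edgeCount, even_ind_iff]
    simp only [coordE, ← huv, ← hxy, ne_eq, hux, not_false_eq_true, true_and]
    tauto

/-- A map respecting coordinates respects edges. -/
lemma coordE_map {W : Type v} {k' : ℕ} {π' : W → Fin k'} {ρ' : Fin k' → W → Prop}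
    {σ : Fin k → Fin k'} (hσ : StrictMono σ) {φ : V → W} (hπ : ∀ x, π' (φ x) = σ (π x))
    (hρ : ∀ t x, t ≠ π x → (ρ' (σ t) (φ x) ↔ ρ t x)) (x y : V) :
    coordE π' ρ' (φ x) (φ y) ↔ coordE π ρ x y := by
  simp only [coordE, hπ, hσ.injective.ne_iff, hσ.lt_iff_lt]
  refine and_congr_right fun h => ?_
  rw [hρ _ _ h, hρ _ _ h.symm]

end coordE

/-- Members of `𝒮*` have coordinates: `π x` is the index of the point of the transversal in the
part of `x`, and `ρ i u` says `t_i → u`. -/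
lemma IsSStar.exists_coord {V : Type u} {E R lt : V → V → Prop} (h : IsSStar E R lt) :
    ∃ (k : ℕ) (π : V → Fin k) (ρ : Fin k → V → Prop), Coord E R lt π ρ := by
  obtain ⟨-, k, F, ltb, hF, hE, hT, hπ, hsurj, hR, hlin, hconv, hlt, hres⟩ := h
  choose π hπ using hπ
  have symm {x y} (h : NonEdge F x y) : NonEdge F y x := hF.nonEdge_equiv.symm h
  have trans {x y z} (h : NonEdge F x y) (h' : NonEdge F y z) : NonEdge F x z :=
    hF.nonEdge_equiv.trans h h'
  have hTT (i j : Fin k) (h : NonEdge F (.inr i) (.inr j)) : i = j := by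
    simp only [NonEdge, hT] at h
    omega
  have hπi (x : V) (i : Fin k) : NonEdge F (.inl x) (.inr i) ↔ π x = i :=
    ⟨fun h => hTT _ _ (trans (symm (hπ x)) h), fun h => h ▸ hπ x⟩
  have hne (x y : V) : NonEdge F (.inl x) (.inl y) ↔ π x = π y :=
    ⟨fun h => ((hπi y _).1 (trans (symm h) (hπ x))).symm,
      fun h => trans ((hπi x _).2 h) (symm (hπ y))⟩
  have hne' (x y : V) : NonEdge E x y ↔ π x = π y := by
    rw [← hne]; simp only [NonEdge, hE]
  refine ⟨k, π, fun i u => F (.inr i) (.inl u), ?_, ?_, ?_, ?_, ?_⟩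
  · intro i
    obtain ⟨x, hx⟩ := hsurj i
    exact ⟨x, (hπi x i).1 hx⟩
  · intro x y
    by_cases h : π x = π y
    · have := ((hne' x y).2 h).1
      simp [coordE, h, this]
    · have hpar := hF.parity (.inl x) (.inr (π x)) (.inl y) (.inr (π y)) (hπ x) (hπ y)
        (by rwa [hne]) (by simp) (by simp)
      rw [edgeCount, even_ind_iff, hE, hT] at hpar
      have h1 : F (.inl x) (.inr (π y)) ↔ ¬ F (.inr (π y)) (.inl x) := by
        have h2 := hF.asymm (.inl x) (.inr (π y))
        have h3 := mt (hπi x (π y)).1 h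
        unfold NonEdge at h3
        tauto
      simp only [coordE, ne_eq, h, not_false_eq_true, true_and]
      tauto
  · intro x u
    rw [hR, hne']
    simp only [hπi, exists_eq_left', ne_eq]
  · have := hlin.comap (f := (Sum.inl : V → V ⊕ Fin k)) Sum.inl_injective
    convert this using 3
    exact hres _ _
  · intro x y hxy
    rw [hres]
    refine (hlin.total (.inl x) (.inl y) (by rintro ⟨⟩; simp at hxy)).resolve_right fun hyx => ?_
    -- Wherever `t_{π x}` stands with respect to `y`, convexity puts `y` into the part of `x`.
    have key : ¬ NonEdge F (.inl y) (.inr (π x)) := fun h => hxy.ne' ((hπi _ _).1 h)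
    rcases hlin.total (.inr (π x)) (.inl y) (by simp) with h | h
    · exact key (symm (hconv _ _ _ h hyx (symm (hπ x))))
    · exact key (hconv _ _ _ h (hlt _ _ hxy) (hπ y))

/-! ### Existence of expansions -/

/-- Every directed graph given by coordinates has an expansion in `𝒮*`: the coordinates extend to
the imaginary points `t_i`. -/
lemma exists_isSStar_coordE {V : Type u} [Finite V] {k : ℕ} {π : V → Fin k} (hπ : Surjective π)
    (ρ : Fin k → V → Prop) : ∃ R lt : V → V → Prop, IsSStar (coordE π ρ) R lt := by
  let π' : V ⊕ Fin k → Fin k := Sum.elim π id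
  let ρ' : Fin k → V ⊕ Fin k → Prop := fun i => Sum.elim (ρ i) (fun j => i < j)
  obtain ⟨m, ⟨e⟩⟩ := Finite.exists_equiv_fin (V ⊕ Fin k)
  let ltb : V ⊕ Fin k → V ⊕ Fin k → Prop := fun x y => π' x < π' y ∨ π' x = π' y ∧ e x < e y
  refine ⟨_, fun x y => ltb (.inl x) (.inl y), isS_coordE π ρ, k, coordE π' ρ', ltb,
    isS_coordE π' ρ', fun x y => Iff.rfl, ?_, fun x => ⟨π x, nonEdge_coordE.2 rfl⟩, ?_,
    fun x u => Iff.rfl, isLinearOrd_lex π' e, ?_, fun i j h => .inl h, fun x y => Iff.rfl⟩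
  · intro i j
    simp only [coordE, π', ρ', Sum.elim_inr, id]
    grind
  · intro i
    obtain ⟨x, rfl⟩ := hπ i
    exact ⟨x, nonEdge_coordE.2 rfl⟩
  · intro x y z hxy hyz hxz
    rw [nonEdge_coordE] at hxz ⊢
    simp only [ltb] at hxy hyz
    grind

/-- Coordinates of a member of `𝒮`: choose a representative `r i` in each part and give `t_i` the
edges of `r i` to the later parts; parity then leaves one choice for its edges to the earlier
ones. -/
lemma IsS.exists_eq_coordE {V : Type u} {E : V → V → Prop} (hE : IsS E) :
    ∃ (k : ℕ) (π : V → Fin k) (ρ : Fin k → V → Prop), Surjective π ∧ E = coordE π ρ := by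
  have := hE.finite
  let s : Setoid V := ⟨NonEdge E, hE.nonEdge_equiv⟩
  obtain ⟨k, ⟨e⟩⟩ := Finite.exists_equiv_fin (Quotient s)
  let π : V → Fin k := fun x => e (Quotient.mk s x)
  have hπ : Surjective π := e.surjective.comp Quotient.mk_surjective
  have hne (x y : V) : NonEdge E x y ↔ π x = π y := by
    simp only [π, e.apply_eq_iff_eq, Quotient.eq]
    rfl
  choose r hr using id hπ
  have hpar (u v x y : V) (huv : π u = π v) (hxy : π x = π y) (hux : π u ≠ π x) :
      (E u x ↔ E u y) ↔ (E v x ↔ E v y) := by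
    by_cases h1 : u = v
    · subst h1; rfl
    by_cases h2 : x = y
    · subst h2; simp
    have := hE.parity u v x y ((hne _ _).2 huv) ((hne _ _).2 hxy) (mt (hne _ _).1 hux) h1 h2
    rwa [edgeCount, even_ind_iff] at this
  let ρ : Fin k → V → Prop := fun i u =>
    if i < π u then E (r i) u else ¬ (E u (r i) ↔ E (r (π u)) (r i))
  have hlt (x y : V) (h : π x < π y) : E x y ↔ coordE π ρ x y := by
    have := hpar x (r (π x)) y (r (π y)) (hr _).symm (hr _).symm h.ne
    simp only [coordE, ρ, h, h.not_gt, h.ne, ne_eq, not_false_eq_true, if_true, if_false]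
    tauto
  refine ⟨k, π, ρ, hπ, ?_⟩
  ext x y
  rcases lt_trichotomy (π x) (π y) with h | h | h
  · exact hlt x y h
  · exact iff_of_false ((hne x y).2 h).1 fun h' => h'.1 h
  · rw [coordE_swap h.ne', ← hlt y x h]
    have h1 := hE.asymm x y
    have h2 := mt (hne x y).1 h.ne'
    unfold NonEdge at h2
    tauto

lemma IsS.exists_isSStar {V : Type u} {E : V → V → Prop} (hE : IsS E) :
    ∃ R lt : V → V → Prop, IsSStar E R lt := by
  have := hE.finite
  obtain ⟨k, π, ρ, hπ, rfl⟩ := hE.exists_eq_coordE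
  exact exists_isSStar_coordE hπ ρ

/-! ### The expansions of `S[n,k]` -/

/-- The edges from the imaginary points to the points of `S[n,k]`. -/
def snkρ (n k : ℕ) (i : Fin k) (p : SnkV n k) : Prop := ∃ h : i ≠ p.1, p.2.1 ⟨i, h⟩ = 0

lemma snkE_eq_coordE (n k : ℕ) : SnkE n k = coordE Sigma.fst (snkρ n k) := by
  ext p q
  by_cases h : p.1 = q.1
  · simp [SnkE, coordE, h]
  · have h' : q.1 ≠ p.1 := Ne.symm h
    simp only [SnkE, coordE, snkρ, ne_eq, h, h', not_false_eq_true, exists_true_left, true_and]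
    rw [← ind_true trivial, even_ind_iff]
    tauto

lemma isS_snkE (n k : ℕ) : IsS (SnkE n k) := snkE_eq_coordE n k ▸ isS_coordE _ _

/-- The relation `R` given by the imaginary points of `S[n,k]`. -/
def snkR (n k : ℕ) (p q : SnkV n k) : Prop := p.1 ≠ q.1 ∧ snkρ n k p.1 q

section Snk

variable {n k l : ℕ} {R lt : SnkV n k → SnkV n k → Prop} {π : SnkV n k → Fin l}
  {ρ : Fin l → SnkV n k → Prop}

lemma Coord.snk_eq_iff (h : Coord (SnkE n k) R lt π ρ) (p q : SnkV n k) :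
    π p = π q ↔ p.1 = q.1 := by
  rw [← nonEdge_coordE (π := π) (ρ := ρ), ← nonEdge_coordE (π := Sigma.fst) (ρ := snkρ n k),
    ← snkE_eq_coordE]
  simp only [NonEdge, h.edge]

lemma Coord.snk_card (hn : n ≠ 0) (h : Coord (SnkE n k) R lt π ρ) : l = k := by
  have : NeZero n := ⟨hn⟩
  have hb : Bijective fun i : Fin k => π ⟨i, 0, 0⟩ := by
    refine ⟨fun i j hij => (h.snk_eq_iff _ _).1 hij, fun i => ?_⟩
    obtain ⟨p, rfl⟩ := h.surj i
    exact ⟨p.1, (h.snk_eq_iff _ _).2 rfl⟩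
  simpa using (Fintype.card_of_bijective hb).symm

open Classical in
/-- The map of `S[n,k]` to itself which turns given coordinates into the standard ones. -/
noncomputable def snkMap (π : SnkV n k → Fin k) (ρ : Fin k → SnkV n k → Prop) (p : SnkV n k) :
    SnkV n k :=
  ⟨π p, fun j => if ρ j p then 0 else 1, p.2.2⟩

lemma snkρ_snkMap (π : SnkV n k → Fin k) (ρ : Fin k → SnkV n k → Prop) {i : Fin k} {p : SnkV n k}
    (hi : i ≠ π p) : snkρ n k i (snkMap π ρ p) ↔ ρ i p := by
  simp [snkρ, snkMap, hi]

/-- Two points of a part with equal coordinates and equal index are joined in the same way to every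
other point, so they are equal; hence `snkMap` permutes the finite set `SnkV n k`. -/
lemma Coord.snkMap_bijective {π : SnkV n k → Fin k} {ρ : Fin k → SnkV n k → Prop}
    (h : Coord (SnkE n k) R lt π ρ) : Bijective (snkMap π ρ) := by
  refine Finite.injective_iff_bijective.1 fun p q hpq => ?_
  have hπ : π p = π q := congrArg Sigma.fst hpq
  have hρ (i : Fin k) (hi : i ≠ π p) : ρ i p ↔ ρ i q := by
    rw [← snkρ_snkMap π ρ hi, hpq, snkρ_snkMap π ρ (hπ ▸ hi)]
  have hj : p.2.2 = q.2.2 := by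
    have := congrArg (fun p : SnkV n k => p.2.2) hpq
    exact this
  obtain ⟨i, f, j⟩ := p
  obtain ⟨i', f', j'⟩ := q
  obtain rfl : i = i' := (h.snk_eq_iff _ _).1 hπ
  obtain rfl : j = j' := hj
  suffices f = f' by rw [this]
  ext ⟨t, ht⟩ : 1
  let q : SnkV n k := ⟨t, 0, j⟩
  have hq (p : SnkV n k) (hp : p.1 = i) : π q ≠ π p := fun h' =>
    ht (((h.snk_eq_iff q p).1 h').trans hp)
  have hE : SnkE n k ⟨i, f, j⟩ q ↔ SnkE n k ⟨i, f', j⟩ q := by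
    rw [h.edge, h.edge, coordE, coordE, hρ _ (hq _ rfl), hπ]
  have hsnk : snkρ n k t ⟨i, f, j⟩ ↔ snkρ n k t ⟨i, f', j⟩ := by
    rw [snkE_eq_coordE] at hE
    simp only [coordE, q, ne_eq, ht.symm, not_false_eq_true, true_and] at hE
    tauto
  simp only [snkρ, ne_eq, ht, not_false_eq_true, exists_true_left] at hsnk
  grind

/-- All expansions of `S[n,k]` are isomorphic to the standard one. -/
lemma isoAS_snkR (h : IsAS (SnkE n k) R) : IsoAS (SnkE n k) R (SnkE n k) (snkR n k) := by
  rcases eq_or_ne n 0 with rfl | hn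
  · exact ⟨Equiv.refl _, fun x => x.2.2.elim0⟩
  obtain ⟨lt, hlt⟩ := h
  obtain ⟨l, π, ρ, hc⟩ := hlt.exists_coord
  obtain rfl := hc.snk_card hn
  refine ⟨Equiv.ofBijective _ hc.snkMap_bijective, fun x y => ⟨?_, ?_⟩⟩
  · rw [hc.edge x y, snkE_eq_coordE]
    exact coordE_map (σ := id) (φ := snkMap π ρ) strictMono_id (fun _ => rfl)
      (fun _ _ => snkρ_snkMap π ρ) x y
  · rw [hc.rel x y]
    exact and_congr_right fun hxy => snkρ_snkMap π ρ hxy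

lemma IsoAS.trans_symm {U : Type*} {V : Type u} {W : Type v} {E R : U → U → Prop}
    {E' R' : V → V → Prop} {E'' R'' : W → W → Prop} (h : IsoAS E R E'' R'')
    (h' : IsoAS E' R' E'' R'') : IsoAS E R E' R' := by
  obtain ⟨φ, hφ⟩ := h
  obtain ⟨ψ, hψ⟩ := h'
  refine ⟨φ.trans ψ.symm, fun x y => ?_⟩
  rw [← (hψ _ _).1, ← (hψ _ _).2]
  simpa using hφ x y

/-- In every expansion of `S[n,k]`, each part contains `n` points of every type over the other
parts. -/
lemma Coord.exists_point {π : SnkV n k → Fin k} {ρ : Fin k → SnkV n k → Prop}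
    (h : Coord (SnkE n k) R lt π ρ) (i : Fin k) (f : Fin k → Prop) (j : Fin n) :
    ∃ p : SnkV n k, π p = i ∧ (∀ t, t ≠ i → (ρ t p ↔ f t)) ∧ p.2.2 = j := by
  classical
  obtain ⟨p, hp⟩ := h.snkMap_bijective.2 ⟨i, fun t => if f t then 0 else 1, j⟩
  have hi : π p = i := congrArg Sigma.fst hp
  refine ⟨p, hi, fun t ht => ?_, congrArg (fun p : SnkV n k => p.2.2) hp⟩
  rw [← snkρ_snkMap π ρ (hi ▸ ht), hp]
  simp [snkρ, ht]

end Snk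

/-! ### Every expansion of a large `S[n,k]` contains a given structure -/

/-- A choice `c` avoiding all bad events exists when each event is rare along the shifts of the
other coordinates of a choice. -/
lemma exists_forall_not_of_card_le {k L D : ℕ} [NeZero L] (Bad : Fin k → (Fin k → Fin L) → Prop)
    (hD : ∀ (i : Fin k) (c : Fin k → Fin L),
      Nat.card {s : Fin L // Bad i (update (fun t => c t + s) i (c i))} ≤ D)
    (hL : k * D < L) : ∃ c, ∀ i, ¬ Bad i c := by
  classical
  by_contra! hall
  -- For fixed `i` and `s`, shifting by `s` off `i` permutes the choices.
  have hbij (i : Fin k) (s : Fin L) :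
      Bijective fun c : Fin k → Fin L => update (fun t => c t + s) i (c i) := by
    refine Finite.injective_iff_bijective.1 fun c c' h => funext fun t => ?_
    have := congrFun h t
    by_cases ht : t = i
    · subst ht; simpa using this
    · simpa [ht] using this
  have hcount (i : Fin k) : L * (Finset.univ.filter (Bad i)).card ≤ L ^ k * D := calc
    _ = ∑ s : Fin L, ∑ c : Fin k → Fin L, if Bad i c then 1 else 0 := by simp
    _ = ∑ s : Fin L, ∑ c : Fin k → Fin L,
          if Bad i (update (fun t => c t + s) i (c i)) then 1 else 0 :=
      Finset.sum_congr rfl fun s _ =>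
        ((hbij i s).sum_comp fun c => if Bad i c then 1 else 0).symm
    _ = ∑ c : Fin k → Fin L, ∑ s : Fin L,
          if Bad i (update (fun t => c t + s) i (c i)) then 1 else 0 := Finset.sum_comm
    _ ≤ ∑ c : Fin k → Fin L, D := Finset.sum_le_sum fun c _ => by
      simpa [Nat.card_eq_fintype_card, Fintype.card_subtype] using hD i c
    _ = L ^ k * D := by simp
  have hcover : L ^ k ≤ ∑ i : Fin k, (Finset.univ.filter (Bad i)).card := calc
    L ^ k = (Finset.univ.biUnion fun i : Fin k => Finset.univ.filter (Bad i)).card := by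
      rw [Finset.eq_univ_of_forall (s := Finset.univ.biUnion _) (by simpa using hall)]
      simp
    _ ≤ _ := Finset.card_biUnion_le
  have : L * L ^ k ≤ k * D * L ^ k := calc
    L * L ^ k ≤ ∑ i : Fin k, L * (Finset.univ.filter (Bad i)).card := by
      rw [← Finset.mul_sum]; gcongr
    _ ≤ ∑ i : Fin k, L ^ k * D := Finset.sum_le_sum fun i _ => hcount i
    _ = k * D * L ^ k := by simp; ring
  exact absurd (Nat.le_of_mul_le_mul_right this (Nat.pow_pos (NeZero.pos L))) hL.not_ge

/-- A map respecting coordinates, and the order inside each part, is an embedding. -/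
lemma Coord.embeds {V : Type u} {W : Type v} {E R lt : V → V → Prop} {E' R' lt' : W → W → Prop}
    {k k' : ℕ} {π : V → Fin k} {ρ : Fin k → V → Prop} {π' : W → Fin k'} {ρ' : Fin k' → W → Prop}
    (h : Coord E R lt π ρ) (h' : Coord E' R' lt' π' ρ') {σ : Fin k → Fin k'} (hσ : StrictMono σ)
    {φ : V → W} (hπ : ∀ x, π' (φ x) = σ (π x))
    (hρ : ∀ t x, t ≠ π x → (ρ' (σ t) (φ x) ↔ ρ t x))
    (hlt : ∀ x y, π x = π y → lt x y → lt' (φ x) (φ y)) : EmbedsSStar E R lt E' R' lt' := by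
  have hmono (x y : V) (hxy : lt x y) : lt' (φ x) (φ y) := by
    rcases lt_trichotomy (π x) (π y) with g | g | g
    · exact h'.mono _ _ (by simpa [hπ] using hσ g)
    · exact hlt x y g hxy
    · exact absurd (h.mono _ _ g) (h.lin.asymm hxy)
  have hinj : Injective φ := fun x y hxy => by
    by_contra hne
    rcases h.lin.total x y hne with g | g <;> have := hmono _ _ g <;> rw [hxy] at this <;>
      exact h'.lin.irrefl _ this
  refine ⟨⟨φ, hinj⟩, fun x y => ⟨?_, ?_, ?_, hmono x y⟩⟩
  · rw [h.edge, h'.edge]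
    exact coordE_map hσ hπ hρ x y
  · rw [h.rel, h'.rel, Embedding.coeFn_mk, hπ, hπ, hσ.injective.ne_iff]
    exact and_congr_right fun hxy => hρ _ _ hxy
  · intro hxy
    by_contra hn
    have hne : y ≠ x := by rintro rfl; exact h'.lin.irrefl _ hxy
    exact h'.lin.asymm hxy (hmono _ _ ((h.lin.total _ _ hne).resolve_right hn))

/-- Let `b (·, s)`, for `s : S`, be disjoint blocks of parts of `S[n,K]`, all avoiding the part `p`.
For at most `|V|!` of them does `p` fail to contain points in the order of `V` whose types over the
block are those of the points of `V` over the parts other than `i`.  Otherwise assign to each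
permutation of `V` a failing block, and take points `x a` in `p` whose type over the block of the
permutation `τ` is that of `τ a`, with different indices so that they are distinct.  Some `τ` sorts
the points `x (τ a)` like `V`, and these show that the block of `τ⁻¹` does not fail.  For simplicity
all points of `V` are placed in `p`; only those of the part `i` are used later. -/
lemma Coord.card_bad_le {V : Type u} [Finite V] {E R lt : V → V → Prop} {k : ℕ} {π : V → Fin k}
    {ρ : Fin k → V → Prop} (h : Coord E R lt π ρ) {n K : ℕ}
    {R' lt' : SnkV n K → SnkV n K → Prop} {π' : SnkV n K → Fin K} {ρ' : Fin K → SnkV n K → Prop}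
    (h' : Coord (SnkE n K) R' lt' π' ρ') (hn : Nat.card V ≤ n) {S : Type*} [Finite S]
    (i : Fin k) (p : Fin K) (b : {t : Fin k // t ≠ i} × S → Fin K) (hb : Injective b)
    (hbp : ∀ x, b x ≠ p) :
    Nat.card {s : S // ¬ ∃ φ : V → SnkV n K, (∀ x, π' (φ x) = p) ∧
      (∀ (t : {t : Fin k // t ≠ i}) (x : V), ρ' (b (t, s)) (φ x) ↔ ρ t x) ∧
      ∀ x y, lt x y → lt' (φ x) (φ y)} ≤ Nat.card (Equiv.Perm V) := by
  classical
  by_contra hcard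
  have : Fintype V := Fintype.ofFinite V
  have : Fintype S := Fintype.ofFinite S
  rw [not_le, Nat.card_eq_fintype_card, Nat.card_eq_fintype_card] at hcard
  obtain ⟨g⟩ := Embedding.nonempty_of_card_le hcard.le
  obtain ⟨e⟩ : Nonempty (V ↪ Fin n) := Embedding.nonempty_of_card_le (by
    simpa [Nat.card_eq_fintype_card] using hn)
  choose x hxp hxt hxe using fun a : V => h'.exists_point p
    (fun q => ∃ (t : {t : Fin k // t ≠ i}) (τ : Equiv.Perm V), q = b (t, (g τ).1) ∧ ρ t (τ a)) (e a)
  have hx : Injective x := fun a a' haa => e.injective (by rw [← hxe, ← hxe, haa])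
  obtain ⟨τ, hτ⟩ := h.lin.exists_perm (h'.lin.comap hx)
  refine (g τ⁻¹).2 ⟨fun a => x (τ a), fun a => hxp _, fun t a => ?_, fun a a' => (hτ a a').1⟩
  rw [hxt _ _ (hbp _)]
  constructor
  · rintro ⟨t', τ', hq, hr⟩
    obtain ⟨rfl, hq'⟩ := Prod.mk.inj (hb hq)
    obtain rfl := g.injective (Subtype.ext hq')
    simpa using hr
  · intro hr
    exact ⟨t, τ⁻¹, rfl, by simpa using hr⟩

/-- Every expansion of a sufficiently large `S[n,K]` contains a given member of `𝒮*`. -/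
lemma Coord.exists_bound {V : Type u} [Finite V] {E R lt : V → V → Prop} {k : ℕ} {π : V → Fin k}
    {ρ : Fin k → V → Prop} (h : Coord E R lt π ρ) :
    ∃ N : ℕ, ∀ n K, N ≤ n → N ≤ K → ∀ (R' lt' : SnkV n K → SnkV n K → Prop) (l : ℕ)
      (π' : SnkV n K → Fin l) (ρ' : Fin l → SnkV n K → Prop),
      Coord (SnkE n K) R' lt' π' ρ' → EmbedsSStar E R lt (SnkE n K) R' lt' := by
  let D := Nat.card (Equiv.Perm V)
  let L := k * D + 1
  refine ⟨max (k * L) (Nat.card V + 1), fun n K hn hK R' lt' l π' ρ' h' => ?_⟩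
  rw [max_le_iff] at hn hK
  obtain rfl := h'.snk_card (by omega)
  -- The parts of `S[n,K]` are arranged in `k` consecutive intervals of length `L`.
  let ι : Fin k × Fin L → Fin l := fun x => Fin.castLE hK.1 (finProdFinEquiv x)
  have hι : Injective ι := (Fin.castLE_injective hK.1).comp finProdFinEquiv.injective
  have hιlt {i j : Fin k} (hij : i < j) (a b : Fin L) : ι (i, a) < ι (j, b) := by
    have h1 : L * i.1 + L ≤ L * j.1 := by
      have := Nat.mul_le_mul_left L (Nat.succ_le_of_lt (Fin.lt_def.1 hij))
      rwa [Nat.mul_succ] at this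
    rw [Fin.lt_def]
    simp only [ι, Fin.val_castLE, finProdFinEquiv_apply_val]
    omega
  -- The part `i` of `V` has no copy in the part `ι (i, c i)` with types taken over the choice `c`.
  let Bad : Fin k → (Fin k → Fin L) → Prop := fun i c => ¬ ∃ φ : V → SnkV n l,
    (∀ x, π' (φ x) = ι (i, c i)) ∧
    (∀ (t : {t : Fin k // t ≠ i}) (x : V), ρ' (ι (t, c t)) (φ x) ↔ ρ t x) ∧
    ∀ x y, lt x y → lt' (φ x) (φ y)
  obtain ⟨c, hc⟩ := exists_forall_not_of_card_le (D := D) Bad (fun i c => by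
    have := h.card_bad_le h' (by omega) i (ι (i, c i))
      (fun x : {t : Fin k // t ≠ i} × Fin L => ι (x.1, c x.1 + x.2))
      (fun x y hxy => by
        have := hι hxy
        simp only [Prod.mk.injEq] at this
        obtain ⟨h1, h2⟩ := this
        have h1 := Subtype.ext h1
        rw [h1, add_right_inj] at h2
        exact Prod.ext h1 h2)
      (fun x hx => x.1.2 (congrArg Prod.fst (hι hx)))
    refine le_of_eq_of_le (Nat.card_congr (Equiv.subtypeEquivRight fun s => ?_)) this
    simp only [Bad, update_self]
    refine not_congr (exists_congr fun φ => and_congr_right fun _ => and_congr_left fun _ =>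
      forall_congr' fun t => ?_)
    rw [update_of_ne t.2]) (Nat.lt_succ_self _)
  simp only [Bad, not_not] at hc
  choose φ hφπ hφρ hφlt using hc
  refine h.embeds h' (σ := fun i => ι (i, c i)) (fun i j hij => hιlt hij _ _)
    (φ := fun x => φ (π x) x) (fun x => hφπ _ _) (fun t x ht => hφρ (π x) ⟨t, ht⟩ x) ?_
  intro x y hxy hlt
  simp only [hxy]
  exact hφlt _ _ _ hlt

lemma IsSStar.exists_bound {V : Type u} {E R lt : V → V → Prop} (h : IsSStar E R lt) :
    ∃ N : ℕ, ∀ n K, N ≤ n → N ≤ K → ∀ (R' lt' : SnkV n K → SnkV n K → Prop) (l : ℕ)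
      (π' : SnkV n K → Fin l) (ρ' : Fin l → SnkV n K → Prop),
      Coord (SnkE n K) R' lt' π' ρ' → EmbedsSStar E R lt (SnkE n K) R' lt' := by
  have := h.1.finite
  obtain ⟨k, π, ρ, hc⟩ := h.exists_coord
  exact hc.exists_bound

/-! ### The graph `S[n,k]` in an arbitrary universe -/

/-- The edge relation of `S[n,k]` on a lift of its universe. -/
def snkLift (n k : ℕ) (x y : ULift.{u} (SnkV n k)) : Prop := SnkE n k x.down y.down

lemma isS_snkLift (n k : ℕ) : IsS (snkLift.{u} n k) := by
  have : snkLift.{u} n k = coordE (fun x => x.down.1) (fun i x => snkρ n k i x.down) := by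
    ext x y
    rw [snkLift, snkE_eq_coordE]
    rfl
  exact this ▸ isS_coordE _ _

/-- Every member of `𝒮*` is contained in every expansion of the lift of a sufficiently large
`S[N,N]`. -/
lemma IsSStar.exists_bound_lift {V : Type u} {E R lt : V → V → Prop} (h : IsSStar E R lt) :
    ∃ N₀ : ℕ, ∀ N, N₀ ≤ N → ∀ R' lt' : ULift.{u} (SnkV N N) → ULift.{u} (SnkV N N) → Prop,
      IsSStar (snkLift N N) R' lt' → EmbedsSStar E R lt (snkLift N N) R' lt' := by
  obtain ⟨N₀, hN₀⟩ := h.exists_bound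
  refine ⟨N₀, fun N hN R' lt' h' => ?_⟩
  obtain ⟨l, π, ρ, hc⟩ := h'.exists_coord
  obtain ⟨φ, hφ⟩ := hN₀ N N hN hN (fun p q => R' ⟨p⟩ ⟨q⟩) (fun p q => lt' ⟨p⟩ ⟨q⟩) l
    (fun p => π ⟨p⟩) (fun i p => ρ i ⟨p⟩)
    { surj := fun i => by
        obtain ⟨x, hx⟩ := hc.surj i
        exact ⟨x.down, hx⟩
      edge := fun p q => hc.edge ⟨p⟩ ⟨q⟩
      rel := fun p q => hc.rel ⟨p⟩ ⟨q⟩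
      lin := hc.lin.comap ULift.up_injective
      mono := fun p q => hc.mono ⟨p⟩ ⟨q⟩ }
  exact ⟨φ.trans ⟨ULift.up, ULift.up_injective⟩, hφ⟩

end Semigeneric

theorem mainTheorem2 :
    -- every member of the semigeneric class has an expansion
    (∀ (A : Type u) (E : A → A → Prop), Semigeneric.IsS E →
      ∃ R lt : A → A → Prop, Semigeneric.IsSStar E R lt) ∧
    -- first lemma
    (∀ (A : Type u) (E R lt : A → A → Prop), Semigeneric.IsSStar E R lt →
      ∃ (B : Type u) (EB RB : B → B → Prop), Semigeneric.IsAS EB RB ∧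
        ∀ ltB : B → B → Prop, Semigeneric.IsSStar EB RB ltB →
          Semigeneric.EmbedsSStar E R lt EB RB ltB) ∧
    -- `S[n,k]` is in the semigeneric class and has, up to isomorphism, one unordered expansion
    (∀ n k : ℕ, Semigeneric.IsS (Semigeneric.SnkE n k) ∧
      ∀ R R' : Semigeneric.SnkV n k → Semigeneric.SnkV n k → Prop,
        Semigeneric.IsAS (Semigeneric.SnkE n k) R →
        Semigeneric.IsAS (Semigeneric.SnkE n k) R' →
        Semigeneric.IsoAS (Semigeneric.SnkE n k) R (Semigeneric.SnkE n k) R') ∧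
    -- second lemma, with a witness of the form `S[n,k]`
    (∀ (B : Type u) (EB RB : B → B → Prop), Semigeneric.IsAS EB RB →
      ∃ n k : ℕ, ∀ R : Semigeneric.SnkV n k → Semigeneric.SnkV n k → Prop,
        Semigeneric.IsAS (Semigeneric.SnkE n k) R →
        Semigeneric.EmbedsAS EB RB (Semigeneric.SnkE n k) R) ∧
    -- the expansion property
    Semigeneric.HasExpansionProperty.{u} Semigeneric.IsSStar Semigeneric.IsS := by
  open Semigeneric in
  refine ⟨fun A E hE => hE.exists_isSStar, fun A E R lt h => ?_, fun n k => ⟨isS_snkE n k,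
    fun R R' h h' => (isoAS_snkR h).trans_symm (isoAS_snkR h')⟩, fun B EB RB h => ?_,
    fun A E hE => ?_⟩
  · obtain ⟨N, hN⟩ := h.exists_bound_lift
    obtain ⟨R', lt', h'⟩ := (isS_snkLift.{u} N N).exists_isSStar
    exact ⟨_, _, R', ⟨lt', h'⟩, fun ltB hB => hN N le_rfl R' ltB hB⟩
  · obtain ⟨lt, hlt⟩ := h
    obtain ⟨N, hN⟩ := hlt.exists_bound
    refine ⟨N, N, fun R ⟨lt', h'⟩ => ?_⟩
    obtain ⟨l, π, ρ, hc⟩ := h'.exists_coord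
    obtain ⟨φ, hφ⟩ := hN N N le_rfl le_rfl R lt' l π ρ hc
    exact ⟨φ, fun x y => ⟨(hφ x y).1, (hφ x y).2.1⟩⟩
  · -- There are finitely many expansions of `A`, so the bounds for them have a maximum.
    have := hE.finite
    choose N hN using fun S : {S : (A → A → Prop) × (A → A → Prop) // IsSStar E S.1 S.2} =>
      S.2.exists_bound_lift
    obtain ⟨M, hM⟩ := (Set.finite_range N).bddAbove
    exact ⟨_, _, isS_snkLift.{u} M M, fun R lt RB ltB h h' =>
      hN ⟨(R, lt), h⟩ M (hM ⟨_, rfl⟩) RB ltB h'⟩
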